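/- Let $\mathcal{A}$ be a finitely cocomplete homological category, that is, a category with a zero object and finite colimits which is regular and protomodular (it has finite limits, kernel pairs have coequalisers, regular epimorphisms are stable under pullback, and the Split Short Five Lemma holds). Write $X\otimes Y$ for the kernel $\iota_{X,Y}\colon X\otimes Y\to X+Y$ of the canonical comparison morphism $X+Y\to X\times Y$, and $X\otimes Y\otimes Z$ for the kernel $\iota_{X,Y,Z}$ of the canonical morphism $X+Y+Z\to (X+Y)\times(X+Z)\times(Y+Z)$. For $f\colon X\to X'$ and $g\colon Y\to Y'$ let $f\otimes g\colon X\otimes Y\to X'\otimes Y'$ be the restriction of $f+g$. Let $S_{2,1}\colon A\otimes A\otimes G\to A\otimes G$ be the restriction of $\nabla_A+1_G\colon A+A+G\to A+G$, and let $c^{G,G}\colon G\otimes G\to G$ be the composite of $\iota_{G,G}$ with the codiagonal $G+G\to G$. Given $\psi\colon A\otimes G\to A$, let $q\colon A+G\to A\rtimes_\psi G$ be the coequaliser of $\iota_{A,G}$ and $\iota_A\circ\psi$, where $\iota_A\colon A\to A+G$ and $\iota_G\colon G\to A+G$ are the coproduct inclusions. Put $k_\psi=q\circ\iota_A$ and $s_\psi=q\circ\iota_G$,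 and let $p_\psi\colon A\rtimes_\psi G\to G$ be the morphism with $p_\psi\circ k_\psi=0$ and $p_\psi\circ s_\psi=1_G$. One says that $\psi$ determines an action of $G$ on $A$ when $k_\psi$ is a monomorphism. Let $A$ be an abelian object (an object carrying an internal Mal'tsev operation $A\times A\times A\to A$) and let $\psi\colon A\otimes G\to A$ determine an action of $G$ on $A$. Then the following are equivalent: 1. $(A,\psi)$ is a $G$-module (Beck module): the object $p_\psi\colon A\rtimes_\psi G\to G$ of the slice category $(\mathcal{A}\downarrow G)$ carries an internal abelian group structure with unit $s_\psi$. 2. $(G,A,\psi,0)$ is a crossed module. Here $(G,A,\mu,\partial)$ is a precrossed module when $\mu\colon A\otimes G\to A$ determines an action and $\partial\colon A\to G$ satisfies $\partial\circ\mu=c^{G,G}\circ(\partial\otimes 1_G)$. It is a crossed module when moreover the reflexive graph with domain $p_\mu\colon A\rtimes_\mu G\to G$, codomain $c\colon A\rtimes_\mu G\to G$ determined by $c\circ k_\mu=\partial$ and $c\circ s_\mu=1_G$, and identities $s_\mu$, carries an internal category structure. 3. The ternary operation $\psi_{2,1}=\psi\circ S_{2,1}\colon A\otimes A\otimes G\to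 A$ is the zero morphism. -/

import Mathlib

open CategoryTheory CategoryTheory.Limits

namespace CoSmash

universe v u

/-- Protomodularity of a pointed finitely complete category: the Split Short Five Lemma.
In a morphism `(a, x, g)` of split extensions (a kernel `k` of a split epimorphism `p` with chosen
section `s`), the middle component `x` is invertible as soon as `a` and `g` are. -/
class IsProtomodular (C : Type u) [Category.{v} C] [HasZeroMorphisms C] : Prop where
  split_short_five {A X G A' X' G' : C}
    {k : A ⟶ X} {p : X ⟶ G} {s : G ⟶ X} {k' : A' ⟶ X'} {p' : X' ⟶ G'} {s' : G' ⟶ X'}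
    (w : k ≫ p = 0) (_ : Nonempty (IsLimit (KernelFork.ofι k w))) (_ : s ≫ p = 𝟙 G)
    (w' : k' ≫ p' = 0) (_ : Nonempty (IsLimit (KernelFork.ofι k' w'))) (_ : s' ≫ p' = 𝟙 G')
    (a : A' ⟶ A) (x : X' ⟶ X) (g : G' ⟶ G)
    (_ : k' ≫ x = a ≫ k) (_ : x ≫ p = p' ≫ g) (_ : s' ≫ x = g ≫ s)
    (_ : IsIso a) (_ : IsIso g) : IsIso x

noncomputable section

attribute [local simp] prod.lift_fst prod.lift_fst_assoc prod.lift_snd prod.lift_snd_assoc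
  coprod.inl_desc coprod.inl_desc_assoc coprod.inr_desc coprod.inr_desc_assoc
  pullback.lift_fst pullback.lift_fst_assoc pullback.lift_snd pullback.lift_snd_assoc
  coequalizer.π_desc coequalizer.π_desc_assoc kernel.lift_ι kernel.lift_ι_assoc

/-- An object is abelian when it carries an internal Mal'tsev operation `g`, that is,
`g(x, x, z) = z` and `g(x, z, z) = x`. -/
def IsAbelianObject {C : Type u} [Category.{v} C] [HasFiniteProducts C] (A : C) : Prop :=
  ∃ g : A ⨯ (A ⨯ A) ⟶ A,
    (∀ {T : C} (x z : T ⟶ A), prod.lift x (prod.lift x z) ≫ g = z) ∧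
    (∀ {T : C} (x z : T ⟶ A), prod.lift x (prod.lift z z) ≫ g = x)

/-! ### Reflexive graphs and internal categories -/

/-- Internal reflexive graphs `d, c : R ⇉ G`, `e : G ⟶ R`. -/
structure ReflexiveGraph (C : Type u) [Category.{v} C] where
  R : C
  G : C
  d : R ⟶ G
  c : R ⟶ G
  e : G ⟶ R
  e_d : e ≫ d = 𝟙 G
  e_c : e ≫ c = 𝟙 G

/-- An internal category structure on a reflexive graph with domain `d`, codomain `c` and
identities `e`: a composition `comp (β, α) = β ∘ α` of the composable pairs, `d β = c α`, which is
compatible with domains and codomains, unital and associative. -/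
structure InternalCategoryStructure {C : Type u} [Category.{v} C] [HasPullbacks C]
    (Γ : ReflexiveGraph C) where
  comp : pullback Γ.d Γ.c ⟶ Γ.R
  comp_d : comp ≫ Γ.d = pullback.snd Γ.d Γ.c ≫ Γ.d
  comp_c : comp ≫ Γ.c = pullback.fst Γ.d Γ.c ≫ Γ.c
  comp_id : pullback.lift (𝟙 Γ.R) (Γ.d ≫ Γ.e) (by simp [Γ.e_c]) ≫ comp = 𝟙 Γ.R
  id_comp : pullback.lift (Γ.c ≫ Γ.e) (𝟙 Γ.R) (by simp [Γ.e_d]) ≫ comp = 𝟙 Γ.R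
  assoc {T : C} (h g f : T ⟶ Γ.R) (hg : h ≫ Γ.d = g ≫ Γ.c) (gf : g ≫ Γ.d = f ≫ Γ.c) :
    pullback.lift (pullback.lift h g hg ≫ comp) f (by simp [comp_d, gf]) ≫ comp =
      pullback.lift h (pullback.lift g f gf ≫ comp) (by simp [comp_c, hg]) ≫ comp

/-- The reflexive graph underlies an internal category. -/
def ReflexiveGraph.IsInternalCategory {C : Type u} [Category.{v} C] [HasPullbacks C]
    (Γ : ReflexiveGraph C) : Prop :=
  Nonempty (InternalCategoryStructure Γ)

/-! ### Beck modules -/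

section Beck

attribute [local instance] Over.cartesianMonoidalCategory Over.braidedCategory

/-- The point `p : X ⟶ G` with section `s : G ⟶ X` is a Beck module over `G`: the object `p` of the
slice category over `G` carries an internal abelian group structure whose unit is `s`.
(The product of the slice category is `X ×_G X`, its terminal object is the identity of `G`.) -/
def IsBeckModulePoint {C : Type u} [Category.{v} C] [HasPullbacks C] {X G : C}
    (p : X ⟶ G) (s : G ⟶ X) (w : s ≫ p = 𝟙 G) : Prop :=
  ∃ _ : GrpObj (Over.mk p), IsCommMonObj (Over.mk p) ∧
    (MonObj.one : MonoidalCategoryStruct.tensorUnit (Over G) ⟶ Over.mk p) =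
      (Over.homMk s w : Over.mk (𝟙 G) ⟶ Over.mk p)

end Beck

/-! ### Co-smash products -/

section

variable {C : Type u} [Category.{v} C] [HasZeroMorphisms C] [HasFiniteLimits C]
  [HasFiniteColimits C]

/-- The comparison morphism `X + Y ⟶ X × Y`. -/
def comparison₂ (X Y : C) : X ⨿ Y ⟶ X ⨯ Y :=
  prod.lift (coprod.desc (𝟙 X) 0) (coprod.desc 0 (𝟙 Y))

/-- The binary co-smash product (tensor product) `X ⊗ Y`: the kernel of `X + Y ⟶ X × Y`. -/
def coSmash (X Y : C) : C := kernel (comparison₂ X Y)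

/-- The kernel inclusion `ι_{X,Y} : X ⊗ Y ⟶ X + Y`. -/
def coSmashι (X Y : C) : coSmash X Y ⟶ X ⨿ Y := kernel.ι (comparison₂ X Y)

/-- The comparison morphism `X + Y + Z ⟶ (X + Y) × (X + Z) × (Y + Z)`. -/
def comparison₃ (X Y Z : C) : X ⨿ (Y ⨿ Z) ⟶ (X ⨿ Y) ⨯ ((X ⨿ Z) ⨯ (Y ⨿ Z)) :=
  prod.lift (coprod.desc coprod.inl (coprod.desc coprod.inr 0))
    (prod.lift (coprod.desc coprod.inl (coprod.desc 0 coprod.inr)) (coprod.desc 0 (𝟙 (Y ⨿ Z))))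

/-- The ternary co-smash product `X ⊗ Y ⊗ Z`: the kernel of
`X + Y + Z ⟶ (X + Y) × (X + Z) × (Y + Z)`. -/
def coSmash₃ (X Y Z : C) : C := kernel (comparison₃ X Y Z)

/-- The kernel inclusion `ι_{X,Y,Z} : X ⊗ Y ⊗ Z ⟶ X + Y + Z`. -/
def coSmash₃ι (X Y Z : C) : coSmash₃ X Y Z ⟶ X ⨿ (Y ⨿ Z) := kernel.ι (comparison₃ X Y Z)

theorem coSmashι_comparison₂ (X Y : C) : coSmashι X Y ≫ comparison₂ X Y = 0 :=
  kernel.condition _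

theorem coSmashι_fst (X Y : C) : coSmashι X Y ≫ coprod.desc (𝟙 X) 0 = 0 := by
  simpa [comparison₂] using congrArg (· ≫ prod.fst) (coSmashι_comparison₂ X Y)

theorem coSmashι_snd (X Y : C) : coSmashι X Y ≫ coprod.desc 0 (𝟙 Y) = 0 := by
  simpa [comparison₂] using congrArg (· ≫ prod.snd) (coSmashι_comparison₂ X Y)

theorem coSmash₃ι_comparison₃ (X Y Z : C) : coSmash₃ι X Y Z ≫ comparison₃ X Y Z = 0 :=
  kernel.condition _

/-- Functoriality: `f ⊗ g : X ⊗ Y ⟶ X' ⊗ Y'`, the restriction of `f + g`. -/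
def coSmashMap {X Y X' Y' : C} (f : X ⟶ X') (g : Y ⟶ Y') : coSmash X Y ⟶ coSmash X' Y' :=
  kernel.map (comparison₂ X Y) (comparison₂ X' Y') (coprod.map f g) (prod.map f g) (by
    ext <;> simp [comparison₂])

theorem coSmashMap_ι {X Y X' Y' : C} (f : X ⟶ X') (g : Y ⟶ Y') :
    coSmashMap f g ≫ coSmashι X' Y' = coSmashι X Y ≫ coprod.map f g :=
  kernel.lift_ι _ _ _

/-- The morphism `c^{X,X} : X ⊗ X ⟶ X`, the restriction of the codiagonal `X + X ⟶ X`; it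
determines the conjugation action of `X` on itself. -/
def conj (X : C) : coSmash X X ⟶ X := coSmashι X X ≫ coprod.desc (𝟙 X) (𝟙 X)

/-- The folding operation `S_{2,1} : X ⊗ X ⊗ Y ⟶ X ⊗ Y`, the restriction of
`∇ + 1 : X + X + Y ⟶ X + Y`. -/
def fold₂₁ (X Y : C) : coSmash₃ X X Y ⟶ coSmash X Y :=
  kernel.lift (comparison₂ X Y)
    (coSmash₃ι X X Y ≫ coprod.desc coprod.inl (𝟙 (X ⨿ Y))) (by
      have h := coSmash₃ι_comparison₃ X X Y
      have h₁ : coSmash₃ι X X Y ≫ coprod.desc coprod.inl (coprod.desc coprod.inr 0) = 0 := by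
        simpa [comparison₃] using congrArg (· ≫ prod.fst) h
      have h₂ : coSmash₃ι X X Y ≫ coprod.desc 0 (𝟙 (X ⨿ Y)) = 0 := by
        simpa [comparison₃] using congrArg (· ≫ prod.snd ≫ prod.snd) h
      ext
      · have h₃ := congrArg (· ≫ coprod.desc (𝟙 X) (𝟙 X)) h₁
        have h₄ : coprod.desc coprod.inl (coprod.desc coprod.inr 0) ≫ coprod.desc (𝟙 X) (𝟙 X) =
            (coprod.desc coprod.inl (𝟙 (X ⨿ Y)) ≫ coprod.desc (𝟙 X) 0 :
              X ⨿ (X ⨿ Y) ⟶ X) := by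
          ext <;> simp
        simp only [Category.assoc, h₄, zero_comp] at h₃
        simpa [comparison₂] using h₃
      · have h₃ := congrArg (· ≫ coprod.desc 0 (𝟙 Y)) h₂
        have h₄ : coprod.desc 0 (𝟙 (X ⨿ Y)) ≫ coprod.desc 0 (𝟙 Y) =
            (coprod.desc coprod.inl (𝟙 (X ⨿ Y)) ≫ coprod.desc 0 (𝟙 Y) :
              X ⨿ (X ⨿ Y) ⟶ Y) := by
          ext <;> simp
        simp only [Category.assoc, h₄, zero_comp] at h₃
        simpa [comparison₂] using h₃)

/-! ### Actions and semi-direct products -/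

variable {A G : C}

/-- The semi-direct product `A ⋊_ψ G`: the coequaliser of `ι_{A,G}` and `ι_A ∘ ψ`. -/
def semidirect (ψ : coSmash A G ⟶ A) : C := coequalizer (coSmashι A G) (ψ ≫ coprod.inl)

/-- The quotient morphism `q : A + G ⟶ A ⋊_ψ G`. -/
def semidirectπ (ψ : coSmash A G ⟶ A) : A ⨿ G ⟶ semidirect ψ :=
  coequalizer.π (coSmashι A G) (ψ ≫ coprod.inl)

/-- `k_ψ : A ⟶ A ⋊_ψ G`. -/
def semidirectK (ψ : coSmash A G ⟶ A) : A ⟶ semidirect ψ := coprod.inl ≫ semidirectπ ψ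

/-- `s_ψ : G ⟶ A ⋊_ψ G`. -/
def semidirectS (ψ : coSmash A G ⟶ A) : G ⟶ semidirect ψ := coprod.inr ≫ semidirectπ ψ

/-- The morphism `⟨f, g⟩ : A ⋊_ψ G ⟶ Z` with restrictions `f` to `A` and `g` to `G`. -/
def semidirectDesc (ψ : coSmash A G ⟶ A) {Z : C} (f : A ⟶ Z) (g : G ⟶ Z)
    (w : coSmashι A G ≫ coprod.desc f g = ψ ≫ f) : semidirect ψ ⟶ Z :=
  coequalizer.desc (coprod.desc f g) (by simpa using w)

/-- `p_ψ : A ⋊_ψ G ⟶ G`, the morphism induced by the retraction `A + G ⟶ G`. -/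
def semidirectP (ψ : coSmash A G ⟶ A) : semidirect ψ ⟶ G :=
  semidirectDesc ψ 0 (𝟙 G) (by rw [coSmashι_snd, comp_zero])

theorem semidirectπ_desc (ψ : coSmash A G ⟶ A) {Z : C} (f : A ⟶ Z) (g : G ⟶ Z)
    (w : coSmashι A G ≫ coprod.desc f g = ψ ≫ f) :
    semidirectπ ψ ≫ semidirectDesc ψ f g w = coprod.desc f g :=
  coequalizer.π_desc _ _

theorem semidirectS_desc (ψ : coSmash A G ⟶ A) {Z : C} (f : A ⟶ Z) (g : G ⟶ Z)
    (w : coSmashι A G ≫ coprod.desc f g = ψ ≫ f) :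
    semidirectS ψ ≫ semidirectDesc ψ f g w = g := by
  rw [semidirectS, Category.assoc, semidirectπ_desc, coprod.inr_desc]

theorem semidirectS_P (ψ : coSmash A G ⟶ A) : semidirectS ψ ≫ semidirectP ψ = 𝟙 G :=
  semidirectS_desc ψ _ _ _

/-- `ψ : A ⊗ G ⟶ A` determines an action of `G` on `A`: the morphism `k_ψ` is a monomorphism. -/
def DeterminesAction (ψ : coSmash A G ⟶ A) : Prop := Mono (semidirectK ψ)

/-- The induced ternary operation `ψ_{2,1} = ψ ∘ S_{2,1} : A ⊗ A ⊗ G ⟶ A`. -/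
def ternary₂₁ (ψ : coSmash A G ⟶ A) : coSmash₃ A A G ⟶ A := fold₂₁ A G ≫ ψ

/-- `(A, ψ)` is a `G`-module: the point `(p_ψ, s_ψ)` over `G` corresponding to the action is a Beck
module. -/
def IsModule (ψ : coSmash A G ⟶ A) : Prop :=
  DeterminesAction ψ ∧ IsBeckModulePoint (semidirectP ψ) (semidirectS ψ) (semidirectS_P ψ)

/-! ### Crossed modules -/

/-- `(G, A, μ, ∂)` is a precrossed module: `μ` determines an action of `G` on `A`, and `∂ : A ⟶ G`
is equivariant for this action and the conjugation action of `G` on itself. -/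
structure IsPrecrossedModule (G A : C) (μ : coSmash A G ⟶ A) (bd : A ⟶ G) : Prop where
  action : DeterminesAction μ
  equivariant : μ ≫ bd = coSmashMap bd (𝟙 G) ≫ conj G

theorem IsPrecrossedModule.desc_condition {G A : C} {μ : coSmash A G ⟶ A} {bd : A ⟶ G}
    (h : IsPrecrossedModule G A μ bd) : coSmashι A G ≫ coprod.desc bd (𝟙 G) = μ ≫ bd := by
  rw [h.equivariant, conj, ← Category.assoc, coSmashMap_ι, Category.assoc]
  congr 1
  ext <;> simp

/-- The reflexive graph associated with a precrossed module `(G, A, μ, ∂)`: the domain is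
`p_μ : A ⋊_μ G ⟶ G`, the codomain is the morphism given by `∂` on `A` and by the identity on `G`,
and the identities are given by `s_μ`. -/
def IsPrecrossedModule.graph {G A : C} {μ : coSmash A G ⟶ A} {bd : A ⟶ G}
    (h : IsPrecrossedModule G A μ bd) : ReflexiveGraph C where
  R := semidirect μ
  G := G
  d := semidirectP μ
  c := semidirectDesc μ bd (𝟙 G) h.desc_condition
  e := semidirectS μ
  e_d := semidirectS_P μ
  e_c := semidirectS_desc μ _ _ _

/-- `(G, A, μ, ∂)` is a crossed module: a precrossed module whose associated reflexive graph is an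
internal category. -/
def IsCrossedModule (G A : C) (μ : coSmash A G ⟶ A) (bd : A ⟶ G) : Prop :=
  ∃ h : IsPrecrossedModule G A μ bd, h.graph.IsInternalCategory

end

end

end CoSmash

/-! Write X for the semi-direct product, with k, p, s its kernel, projection and section. Each of
the three conditions amounts to a morphism X ×_G X → X having s as a two-sided unit
(`UnitalMultiplication`).

Protomodularity makes this weak structure sufficient. The two copies of X in X ×_G X are jointly
epimorphic (`pullback_self_hom_ext`), so a unital multiplication is automatically fibrewise,
commutative and associative, and its shear map is invertible by the Split Short Five Lemma
(`isIso_shear`). Hence it is an abelian group over G; and since ∂ = 0 makes the codomain equal to p,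
it is also the composition of an internal category.

Consider the morphisms a = ⟨k, 0, s⟩, b = ⟨0, k, s⟩ and c = ⟨k, k, s⟩ from A + A + G to X. A
multiplication gives c = a · b. As a and b vanish on A ⊗ A ⊗ G, so does c, whose restriction there
is k ∘ ψ_{2,1}; and k is monic.

Conversely, (a, b) : A + A + G → X ×_G X is a regular epimorphism, so a multiplication exists once c
vanishes on its kernel. On the kernel of A + A + G → G the three morphisms land in A, and the claim
is c = a + b, with the sum taken from the Mal'tsev operation. By `kernel_retractionThird_hom_ext` it
is enough to test this on the parts lying in the two copies of A + G, on A ⊗ A and on A ⊗ A ⊗ G. The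
first two are immediate, the third uses that A is abelian, and the last is the hypothesis ψ_{2,1} =
0. -/

namespace CoSmash

universe v u

attribute [local simp] prod.lift_fst prod.lift_fst_assoc prod.lift_snd prod.lift_snd_assoc
  coprod.inl_desc coprod.inl_desc_assoc coprod.inr_desc coprod.inr_desc_assoc
  pullback.lift_fst pullback.lift_fst_assoc pullback.lift_snd pullback.lift_snd_assoc
  coequalizer.π_desc coequalizer.π_desc_assoc kernel.lift_ι kernel.lift_ι_assoc

/-! ### Split epimorphisms in a protomodular category -/

section Points

variable {C : Type u} [Category.{v} C] [HasZeroMorphisms C]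

/-- In a protomodular category, the kernel and the section of a split epimorphism are jointly
extremally epimorphic. -/
theorem isIso_of_mono_of_factors [IsProtomodular C] {A X G M : C} {k : A ⟶ X} {p : X ⟶ G}
    {s : G ⟶ X} {w : k ≫ p = 0} (hk : IsLimit (KernelFork.ofι k w)) (hs : s ≫ p = 𝟙 G)
    (m : M ⟶ X) [Mono m] (k' : A ⟶ M) (hk' : k' ≫ m = k) (s' : G ⟶ M) (hs' : s' ≫ m = s) :
    IsIso m := by
  have w' : k' ≫ m ≫ p = 0 := by rw [← Category.assoc, hk', w]
  have : Mono k' := by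
    have : Mono (k' ≫ m) := by
      rw [hk']; exact mono_of_isLimit_fork hk
    exact mono_of_mono k' m
  -- Since `m` is monic and contains `k`, the restriction of `p` to `M` has the same kernel `A`. The
  -- Five Lemma then applies to `m` with identities at both ends.
  have hlim : IsLimit (KernelFork.ofι k' w') :=
    KernelFork.IsLimit.ofι' _ _ fun {T} t ht => by
      have ht' : (t ≫ m) ≫ p = 0 := by simpa using ht
      refine ⟨hk.lift (KernelFork.ofι (t ≫ m) ht'), ?_⟩
      have := hk.fac (KernelFork.ofι (t ≫ m) ht') WalkingParallelPair.zero
      rw [← cancel_mono m, Category.assoc, hk']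
      simpa using this
  exact IsProtomodular.split_short_five w ⟨hk⟩ hs w' ⟨hlim⟩
    (by rw [← Category.assoc, hs', hs]) (𝟙 A) m (𝟙 G) (by simp [hk']) (by simp) (by simp [hs'])
    inferInstance inferInstance

/-- In a protomodular category, the kernel and the section of a split epimorphism are jointly
epimorphic. -/
theorem hom_ext_of_split [HasFiniteLimits C] [IsProtomodular C] {A X G Z : C} {k : A ⟶ X} {p : X ⟶ G} {s : G ⟶ X}
    {w : k ≫ p = 0} (hk : IsLimit (KernelFork.ofι k w)) (hs : s ≫ p = 𝟙 G)
    {f g : X ⟶ Z} (h₁ : k ≫ f = k ≫ g) (h₂ : s ≫ f = s ≫ g) : f = g := by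
  have := isIso_of_mono_of_factors hk hs (equalizer.ι f g) (equalizer.lift k h₁)
    (equalizer.lift_ι _ _) (equalizer.lift s h₂) (equalizer.lift_ι _ _)
  rw [← cancel_epi (equalizer.ι f g), equalizer.condition]

/-- The kernel of the projection `B ×_G X ⟶ B` is the kernel of `p : X ⟶ G`. -/
theorem nonempty_isLimit_kernel_pullback_fst [HasPullbacks C] {A B X G : C} {k : A ⟶ X} {p : X ⟶ G}
    {w : k ≫ p = 0} (hk : IsLimit (KernelFork.ofι k w)) (a : B ⟶ G)
    (w' : pullback.lift 0 k (by simp [w]) ≫ pullback.fst a p = 0) :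
    Nonempty (IsLimit (KernelFork.ofι (pullback.lift 0 k (by simp [w])) w')) := by
  have hmono : Mono k := mono_of_isLimit_fork hk
  have : Mono (pullback.lift (0 : A ⟶ B) k (by simp [w]) : A ⟶ pullback a p) :=
    mono_of_mono_fac (pullback.lift_snd (f := a) (g := p) (0 : A ⟶ B) k (by simp [w]))
  refine ⟨KernelFork.IsLimit.ofι' _ _ fun {T} t ht => ?_⟩
  have ht' : (t ≫ pullback.snd a p) ≫ p = 0 := by
    rw [Category.assoc, ← pullback.condition, ← Category.assoc, ht, zero_comp]
  refine ⟨hk.lift (KernelFork.ofι (t ≫ pullback.snd a p) ht'), ?_⟩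
  have := hk.fac (KernelFork.ofι (t ≫ pullback.snd a p) ht') WalkingParallelPair.zero
  apply pullback.hom_ext
  · simpa using ht.symm
  · simpa using this

variable [HasFiniteLimits C] [IsProtomodular C] {X G : C} {p : X ⟶ G} {s : G ⟶ X}

/-- The first projection of the pullback is split by (1, s a), and its kernel is that of `p`. -/
theorem pullback_hom_ext_of_split {B Z : C} (hs : s ≫ p = 𝟙 G) (a : B ⟶ G)
    {f g : pullback a p ⟶ Z}
    (h₁ : pullback.lift (𝟙 B) (a ≫ s) (by simp [hs]) ≫ f =
      pullback.lift (𝟙 B) (a ≫ s) (by simp [hs]) ≫ g)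
    (h₂ : (pullback.lift 0 (kernel.ι p) (by simp) : kernel p ⟶ pullback a p) ≫ f =
      (pullback.lift 0 (kernel.ι p) (by simp) : kernel p ⟶ pullback a p) ≫ g) : f = g := by
  obtain ⟨hk⟩ := nonempty_isLimit_kernel_pullback_fst (w := kernel.condition p) (kernelIsKernel p) a (by simp)
  exact hom_ext_of_split hk (s := pullback.lift (𝟙 B) (a ≫ s) (by simp [hs])) (by simp) h₂ h₁

theorem pullback_self_hom_ext {Z : C} (hs : s ≫ p = 𝟙 G) {f g : pullback p p ⟶ Z}
    (h₁ : pullback.lift (𝟙 X) (p ≫ s) (by simp [hs]) ≫ f =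
      pullback.lift (𝟙 X) (p ≫ s) (by simp [hs]) ≫ g)
    (h₂ : pullback.lift (p ≫ s) (𝟙 X) (by simp [hs]) ≫ f =
      pullback.lift (p ≫ s) (𝟙 X) (by simp [hs]) ≫ g) : f = g := by
  refine pullback_hom_ext_of_split hs p h₁ ?_
  have h : (pullback.lift 0 (kernel.ι p) (by simp) : kernel p ⟶ pullback p p) =
      kernel.ι p ≫ pullback.lift (p ≫ s) (𝟙 X) (by simp [hs]) := by
    ext <;> simp
  simpa [h] using congrArg (kernel.ι p ≫ ·) h₂

end Points

/-! ### Multiplications with a unit on a point -/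

section UnitalMultiplication

variable {C : Type u} [Category.{v} C] [HasPullbacks C]

/-- A multiplication on the point `(p, s)`, for which `s` is a two-sided unit. -/
structure UnitalMultiplication {X G : C} (p : X ⟶ G) (s : G ⟶ X) (hs : s ≫ p = 𝟙 G) where
  mul : pullback p p ⟶ X
  mul_one : pullback.lift (𝟙 X) (p ≫ s) (by simp [hs]) ≫ mul = 𝟙 X
  one_mul : pullback.lift (p ≫ s) (𝟙 X) (by simp [hs]) ≫ mul = 𝟙 X

end UnitalMultiplication

namespace UnitalMultiplication

section

variable {C : Type u} [Category.{v} C] [HasPullbacks C] {X G : C} {p : X ⟶ G} {s : G ⟶ X}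
  {hs : s ≫ p = 𝟙 G} (m : UnitalMultiplication p s hs)

/-- The product of two generalized elements in the same fibre. -/
noncomputable def op {T : C} (x y : T ⟶ X) (h : x ≫ p = y ≫ p) : T ⟶ X :=
  pullback.lift x y h ≫ m.mul

theorem comp_op {S T : C} (t : S ⟶ T) (x y : T ⟶ X) (h : x ≫ p = y ≫ p) :
    t ≫ m.op x y h = m.op (t ≫ x) (t ≫ y) (by simp [h]) := by
  rw [op, op, ← Category.assoc]
  congr 1
  ext <;> simp

theorem op_congr {T : C} {x x' y y' : T ⟶ X} (h : x ≫ p = y ≫ p) (hx : x = x') (hy : y = y') :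
    m.op x y h = m.op x' y' (by rw [← hx, ← hy, h]) := by
  subst hx hy; rfl

theorem op_one {T : C} (x y : T ⟶ X) (h : x ≫ p = y ≫ p) (hy : y = x ≫ p ≫ s) :
    m.op x y h = x := by
  have := m.comp_op x (𝟙 X) (p ≫ s) (by simp [hs])
  rw [op, m.mul_one] at this
  exact (m.op_congr h (Category.comp_id x).symm hy).trans (this.symm.trans (Category.comp_id x))

theorem one_op {T : C} (x y : T ⟶ X) (h : x ≫ p = y ≫ p) (hx : x = y ≫ p ≫ s) :
    m.op x y h = y := by
  have := m.comp_op y (p ≫ s) (𝟙 X) (by simp [hs])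
  rw [op, m.one_mul] at this
  exact (m.op_congr h hx (Category.comp_id y).symm).trans (this.symm.trans (Category.comp_id y))

theorem comp_op_congr {S T : C} (t : S ⟶ T) {x x' y y' : T ⟶ X} (h : x ≫ p = y ≫ p)
    (h' : x' ≫ p = y' ≫ p) (hx : t ≫ x = t ≫ x') (hy : t ≫ y = t ≫ y') :
    t ≫ m.op x y h = t ≫ m.op x' y' h' :=
  (m.comp_op t x y h).trans ((m.op_congr _ hx hy).trans (m.comp_op t x' y' h').symm)

theorem comp_op_one {S T : C} (t : S ⟶ T) (x y : T ⟶ X) (h : x ≫ p = y ≫ p)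
    (hy : t ≫ y = t ≫ x ≫ p ≫ s) : t ≫ m.op x y h = t ≫ x :=
  (m.comp_op t x y h).trans (m.op_one _ _ _ (by simpa using hy))

theorem comp_one_op {S T : C} (t : S ⟶ T) (x y : T ⟶ X) (h : x ≫ p = y ≫ p)
    (hx : t ≫ x = t ≫ y ≫ p ≫ s) : t ≫ m.op x y h = t ≫ y :=
  (m.comp_op t x y h).trans (m.one_op _ _ _ (by simpa using hx))

theorem mul_eq_op : m.mul = m.op (pullback.fst p p) (pullback.snd p p) pullback.condition := by
  have : pullback.lift (pullback.fst p p) (pullback.snd p p) pullback.condition = 𝟙 _ := by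
    ext <;> simp
  rw [op, this, Category.id_comp]

end

variable {C : Type u} [Category.{v} C] [HasZeroMorphisms C] [HasFiniteLimits C] [IsProtomodular C]
  {X G : C} {p : X ⟶ G} {s : G ⟶ X} {hs : s ≫ p = 𝟙 G} (m : UnitalMultiplication p s hs)

/-- Compatibility with `p` need not be assumed: it can be tested on the pairs (x, 1) and (1, x),
where the unit laws decide it. -/
theorem mul_p : m.mul ≫ p = pullback.fst p p ≫ p := by
  apply pullback_self_hom_ext hs
  · rw [← Category.assoc, m.mul_one]; simp
  · rw [← Category.assoc, m.one_mul]; simp [hs]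

theorem op_p {T : C} (x y : T ⟶ X) (h : x ≫ p = y ≫ p) : m.op x y h ≫ p = x ≫ p := by
  simp [op, m.mul_p]

theorem op_p_assoc {T Z : C} (x y : T ⟶ X) (h : x ≫ p = y ≫ p) (t : G ⟶ Z) :
    m.op x y h ≫ p ≫ t = x ≫ p ≫ t := by
  rw [← Category.assoc, m.op_p, Category.assoc]

/-- An Eckmann–Hilton phenomenon: on (x, 1) and (1, x) both orders of multiplication give x, and
these pairs are jointly epimorphic. -/
theorem op_comm {T : C} (x y : T ⟶ X) (h : x ≫ p = y ≫ p) : m.op y x h.symm = m.op x y h := by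
  have key : m.op (pullback.snd p p) (pullback.fst p p) pullback.condition.symm =
      m.op (pullback.fst p p) (pullback.snd p p) pullback.condition := by
    apply pullback_self_hom_ext hs
    · rw [comp_one_op, comp_op_one] <;> simp
    · rw [comp_op_one, comp_one_op] <;> simp
  simpa [comp_op] using congrArg (pullback.lift x y h ≫ ·) key

theorem op_assoc {T : C} (x y z : T ⟶ X) (h : x ≫ p = y ≫ p) (h' : y ≫ p = z ≫ p) :
    m.op (m.op x y h) z (by rw [m.op_p, h, h']) =
      m.op x (m.op y z h') (by rw [m.op_p, h]) := by
  -- The universal case is the triple fibre product, seen as a pullback along `a`. It suffices to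
  -- test triples (x, y, 1) and triples (1, 1, z) with z in the kernel.
  let a : pullback p p ⟶ G := pullback.fst p p ≫ p
  let x₀ : pullback a p ⟶ X := pullback.fst a p ≫ pullback.fst p p
  let y₀ : pullback a p ⟶ X := pullback.fst a p ≫ pullback.snd p p
  let z₀ : pullback a p ⟶ X := pullback.snd a p
  have h₀ : x₀ ≫ p = y₀ ≫ p := by simp [x₀, y₀, pullback.condition]
  have h₀' : y₀ ≫ p = z₀ ≫ p := by
    rw [← h₀]
    simpa [x₀, z₀, a] using pullback.condition (f := a) (g := p)
  have key : m.op (m.op x₀ y₀ h₀) z₀ (by rw [m.op_p, h₀, h₀']) =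
      m.op x₀ (m.op y₀ z₀ h₀') (by rw [m.op_p, h₀]) := by
    apply pullback_hom_ext_of_split hs a
    · have hy : pullback.snd p p ≫ p = pullback.fst p p ≫ p := pullback.condition.symm
      rw [comp_op_one _ _ _ _ _ (by simp [x₀, z₀, a, m.op_p_assoc])]
      apply comp_op_congr _ _ _ _ rfl
      rw [comp_op_one]
      simp [y₀, z₀, a, reassoc_of% hy]
    · rw [comp_one_op, comp_one_op, comp_one_op]
      · simp [y₀, z₀]
      · rw [m.op_p_assoc]
        simp [x₀, y₀]
      · rw [comp_op_one] <;> simp [x₀, y₀, z₀]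
  simpa [comp_op, x₀, y₀, z₀] using
    congrArg (pullback.lift (pullback.lift x y h) z (by simp [a, h, h']) ≫ ·) key

/-- The shear map `(x, y) ↦ (x, xy)` is invertible. -/
theorem isIso_shear : IsIso (pullback.lift (pullback.fst p p) m.mul m.mul_p.symm) := by
  have w : (pullback.lift 0 (kernel.ι p) (by simp) : kernel p ⟶ pullback p p) ≫
    pullback.fst p p = 0 := by simp
  have hk := nonempty_isLimit_kernel_pullback_fst (w := kernel.condition p) (kernelIsKernel p) p w
  have hs' : pullback.lift (𝟙 X) (p ≫ s) (by simp [hs]) ≫ pullback.fst p p = 𝟙 X := by simp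
  have hσ : pullback.lift (pullback.fst p p) m.mul m.mul_p.symm ≫ pullback.snd p p =
      m.op (pullback.fst p p) (pullback.snd p p) pullback.condition :=
    (pullback.lift_snd _ _ _).trans m.mul_eq_op
  -- The shear map sends (x, 1) to (x, x), so the target must be split by the diagonal rather than
  -- by (1, s p). On the kernel of the first projection it is the identity.
  have hΔ : pullback.lift (𝟙 X) (𝟙 X) rfl ≫ pullback.fst p p = 𝟙 X := by simp
  refine IsProtomodular.split_short_five w hk hΔ w hk hs' (𝟙 _) _ (𝟙 _) ?_ ?_ ?_ inferInstance
    inferInstance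
  · ext
    · simp
    · rw [Category.assoc, hσ, m.comp_one_op] <;> simp
  · simp
  · ext
    · simp
    · simp [m.mul_one]

theorem exists_inv : ∃ (i : X ⟶ X) (hi : i ≫ p = p),
    m.op (𝟙 X) i (by simp [hi]) = p ≫ s := by
  have := m.isIso_shear
  let σ := pullback.lift (pullback.fst p p) m.mul m.mul_p.symm
  have h₁ : inv σ ≫ pullback.fst p p = pullback.fst p p := by simp [σ]
  have h₂ : inv σ ≫ m.mul = pullback.snd p p := by simp [σ]
  -- The inverse shear map sends (x, 1) to (x, x⁻¹).
  let u : X ⟶ pullback p p := pullback.lift (𝟙 X) (p ≫ s) (by simp [hs])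
  have h₃ : u ≫ inv σ ≫ pullback.fst p p = 𝟙 X := by rw [h₁]; simp [u]
  refine ⟨u ≫ inv σ ≫ pullback.snd p p, ?_, ?_⟩
  · rw [Category.assoc, Category.assoc, ← pullback.condition, reassoc_of% h₁]
    simp [u]
  · have h₄ : u ≫ inv σ ≫ m.mul = p ≫ s := by rw [h₂]; simp [u]
    rw [m.mul_eq_op, comp_op, comp_op] at h₄
    exact (m.op_congr _ h₃.symm rfl).trans h₄

/-- A unital multiplication on a point is the composition of an internal category. -/
noncomputable def internalCategoryStructure :
    InternalCategoryStructure (⟨X, G, p, p, s, hs, hs⟩ : ReflexiveGraph C) where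
  comp := m.mul
  comp_d := by rw [m.mul_p, pullback.condition]
  comp_c := m.mul_p
  comp_id := m.mul_one
  id_comp := m.one_mul
  assoc h g f hg gf := m.op_assoc h g f hg gf

end UnitalMultiplication

/-! ### Monoid objects through generalized elements -/

section CartesianMonoidal

open MonoidalCategory CartesianMonoidalCategory

variable {D : Type u} [Category.{v} D] [CartesianMonoidalCategory D] {M : D}

/-- A monoid object is given by a multiplication satisfying the laws on generalized elements. -/
abbrev monObjOfGeneralizedElements (η : 𝟙_ D ⟶ M) (μ : M ⊗ M ⟶ M)
    (h₁ : ∀ {T : D} (x : T ⟶ M), lift (toUnit T ≫ η) x ≫ μ = x)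
    (h₂ : ∀ {T : D} (x : T ⟶ M), lift x (toUnit T ≫ η) ≫ μ = x)
    (h₃ : ∀ {T : D} (x y z : T ⟶ M), lift (lift x y ≫ μ) z ≫ μ = lift x (lift y z ≫ μ) ≫ μ) :
    MonObj M where
  one := η
  mul := μ
  one_mul := by
    have h : η ▷ M = lift (toUnit _ ≫ η) (snd _ _) := by
      ext
      · simp only [whiskerRight_fst, lift_fst]
        congr 1
        exact toUnit_unique _ _
      · simp
    rw [h, h₁, leftUnitor_hom]
  mul_one := by
    have h : M ◁ η = lift (fst _ _) (toUnit _ ≫ η) := by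
      ext
      · simp
      · simp only [whiskerLeft_snd, lift_snd]
        congr 1
        exact toUnit_unique _ _
    rw [h, h₂, rightUnitor_hom]
  mul_assoc := by
    have h := h₃ (fst (M ⊗ M) M ≫ fst M M) (fst (M ⊗ M) M ≫ snd M M) (snd (M ⊗ M) M)
    rw [← comp_lift, lift_fst_snd, Category.comp_id] at h
    have e₁ : μ ▷ M = lift (fst (M ⊗ M) M ≫ μ) (snd (M ⊗ M) M) := by ext <;> simp
    have e₂ : (α_ M M M).hom ≫ M ◁ μ = lift (fst (M ⊗ M) M ≫ fst M M)
        (lift (fst (M ⊗ M) M ≫ snd M M) (snd (M ⊗ M) M) ≫ μ) := by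
      ext
      · simp
      · simp only [Category.assoc, whiskerLeft_snd, lift_snd]
        rw [← Category.assoc]
        congr 1
        ext <;> simp
    rw [e₁, h, ← e₂, Category.assoc]

end CartesianMonoidal

/-! ### Beck modules and unital multiplications -/

section Beck

attribute [local instance] Over.cartesianMonoidalCategory Over.braidedCategory

open MonoidalCategory CartesianMonoidalCategory

variable {C : Type u} [Category.{v} C] {X G : C} {p : X ⟶ G} {s : G ⟶ X}

theorem UnitalMultiplication.isBeckModulePoint [HasZeroMorphisms C] [HasFiniteLimits C]
    [IsProtomodular C] {hs : s ≫ p = 𝟙 G} (m : UnitalMultiplication p s hs) :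
    IsBeckModulePoint p s hs := by
  let μ : (Over.mk p ⊗ Over.mk p : Over G) ⟶ Over.mk p := Over.homMk m.mul m.mul_p
  let η : 𝟙_ (Over G) ⟶ Over.mk p := Over.homMk s hs
  -- Products in the slice are the chosen pullbacks, so this holds by definition.
  have hop : ∀ {T : Over G} (x y : T ⟶ Over.mk p),
      (lift x y ≫ μ).left = m.op x.left y.left ((Over.w x).trans (Over.w y).symm) :=
    fun x y => rfl
  have hη : ∀ {T : Over G} (x : T ⟶ Over.mk p), (toUnit T ≫ η).left = x.left ≫ p ≫ s := by
    intro T x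
    have hx : x.left ≫ p = T.hom := Over.w x
    rw [← Category.assoc, hx]
    rfl
  obtain ⟨i, hi, hinv⟩ := m.exists_inv
  let M : MonObj (Over.mk p) := monObjOfGeneralizedElements η μ
    (fun x => by ext; exact (hop _ _).trans (m.one_op _ _ _ (hη x)))
    (fun x => by ext; exact (hop _ _).trans (m.op_one _ _ _ (hη x)))
    (fun x y z => by
      ext
      refine (hop _ _).trans ((m.op_congr _ (hop x y) rfl).trans ((m.op_assoc x.left y.left z.left
        ((Over.w x).trans (Over.w y).symm) ((Over.w y).trans (Over.w z).symm)).trans ?_))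
      exact (m.op_congr _ rfl (hop y z)).symm.trans (hop _ _).symm)
  let Γ : GrpObj (Over.mk p) :=
    { inv := Over.homMk i hi
      left_inv := by
        ext
        exact (m.op_comm _ _ _).trans hinv
      right_inv := by
        ext
        exact hinv }
  refine ⟨Γ, ⟨?_⟩, rfl⟩
  have h₁ : μ = lift (fst _ _) (snd _ _) ≫ μ := by rw [lift_fst_snd, Category.id_comp]
  have h₂ : (β_ (Over.mk p) (Over.mk p)).hom = lift (snd _ _) (fst _ _) := by
    ext <;> simp
  change (β_ (Over.mk p) (Over.mk p)).hom ≫ μ = μ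
  rw [h₂]
  conv_rhs => rw [h₁]
  ext
  exact (hop _ _).trans ((m.op_comm _ _ _).trans (hop _ _).symm)

/-- Only the unit laws of the group structure are retained. -/
theorem IsBeckModulePoint.nonempty_unitalMultiplication [HasPullbacks C] {hs : s ≫ p = 𝟙 G}
    (h : IsBeckModulePoint p s hs) : Nonempty (UnitalMultiplication p s hs) := by
  obtain ⟨Γ, -, hη⟩ := h
  have h₁ := MonObj.lift_comp_one_right (𝟙 (Over.mk p)) (toUnit (Over.mk p))
  have h₂ := MonObj.lift_comp_one_left (toUnit (Over.mk p)) (𝟙 (Over.mk p))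
  rw [hη] at h₁ h₂
  exact ⟨⟨(MonObj.mul (X := Over.mk p)).left, congrArg Over.Hom.left h₁,
    congrArg Over.Hom.left h₂⟩⟩

end Beck

/-! ### Generation by idempotents, cokernels, and fibre products -/

section Protomodular

variable {C : Type u} [Category.{v} C] [HasZeroMorphisms C] [HasFiniteLimits C] [IsProtomodular C]

/-- An idempotent and its kernel are jointly epimorphic. -/
theorem hom_ext_of_idempotent {Y Z : C} {e : Y ⟶ Y} (he : e ≫ e = e) {f g : Y ⟶ Z}
    (h₁ : e ≫ f = e ≫ g) (h₂ : ∀ {T : C} (t : T ⟶ Y), t ≫ e = 0 → t ≫ f = t ≫ g) : f = g := by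
  -- The idempotent is split through its object of fixed points; the kernel of the resulting split
  -- epimorphism consists of what `e` kills.
  let p : Y ⟶ equalizer e (𝟙 Y) := equalizer.lift e (by simp [he])
  have hp : p ≫ equalizer.ι e (𝟙 Y) = e := equalizer.lift_ι _ _
  have hι : equalizer.ι e (𝟙 Y) ≫ e = equalizer.ι e (𝟙 Y) := by
    rw [equalizer.condition, Category.comp_id]
  have hs : equalizer.ι e (𝟙 Y) ≫ p = 𝟙 _ := by
    rw [← cancel_mono (equalizer.ι e (𝟙 Y)), Category.assoc, hp, hι, Category.id_comp]
  refine hom_ext_of_split (w := kernel.condition p) (kernelIsKernel p) hs ?_ ?_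
  · refine h₂ _ ?_
    have := kernel.condition_assoc p (equalizer.ι e (𝟙 Y))
    rwa [hp, zero_comp] at this
  · rw [← hι, Category.assoc, Category.assoc, h₁]

/-- A relative version of `hom_ext_of_idempotent`: the kernel of `h`, on which an idempotent `e`
acts, is generated by its elements fixed by `e` and its elements killed by `e`. -/
theorem comp_eq_comp_of_idempotent {Y V Z : C} {e : Y ⟶ Y} (he : e ≫ e = e) {f g : Y ⟶ Z}
    (h : Y ⟶ V) (e' : V ⟶ V) (hh : e ≫ h = h ≫ e')
    (h₁ : ∀ {T : C} (t : T ⟶ Y), t ≫ h = 0 → t ≫ e = t → t ≫ f = t ≫ g)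
    (h₂ : ∀ {T : C} (t : T ⟶ Y), t ≫ h = 0 → t ≫ e = 0 → t ≫ f = t ≫ g)
    {T : C} (t : T ⟶ Y) (ht : t ≫ h = 0) : t ≫ f = t ≫ g := by
  let ε : kernel h ⟶ kernel h := kernel.lift h (kernel.ι h ≫ e) (by simp [hh])
  have hε : ε ≫ kernel.ι h = kernel.ι h ≫ e := kernel.lift_ι _ _ _
  have key : kernel.ι h ≫ f = kernel.ι h ≫ g := by
    refine hom_ext_of_idempotent (e := ε) ?_ ?_ ?_
    · rw [← cancel_mono (kernel.ι h), Category.assoc, hε, reassoc_of% hε, he]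
    · rw [reassoc_of% hε, reassoc_of% hε]
      simpa using h₁ (kernel.ι h ≫ e) (by simp [hh]) (by simp [he])
    · intro T t ht
      simpa using h₂ (t ≫ kernel.ι h) (by simp) (by rw [Category.assoc, ← hε, ← Category.assoc, ht,
        zero_comp])
  have := congrArg (kernel.lift h t ht ≫ ·) key
  simpa using this

/-- In a protomodular category, every regular epimorphism is a cokernel of its kernel. -/
theorem exists_desc_of_kernel_comp_eq_zero {W P Z : C} (r : W ⟶ P) [IsRegularEpi r] (f : W ⟶ Z)
    (hf : kernel.ι r ≫ f = 0) : ∃ g : P ⟶ Z, r ≫ g = f := by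
  -- The kernel pair is generated by the diagonal and by the pairs (0, x) with x in the kernel of
  -- `r`.
  have key : pullback.fst r r ≫ f = pullback.snd r r ≫ f := by
    obtain ⟨hk⟩ := nonempty_isLimit_kernel_pullback_fst (w := kernel.condition r)
      (kernelIsKernel r) r (by simp)
    refine hom_ext_of_split hk (s := pullback.lift (𝟙 W) (𝟙 W) rfl) (by simp) ?_ ?_ <;> simp [hf]
  let R := IsRegularEpi.getStruct r
  have hw : R.left ≫ f = R.right ≫ f := by
    simpa using congrArg (pullback.lift R.left R.right R.w ≫ ·) key
  exact ⟨_, (RegularEpi.desc' R f hw).2⟩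

/-- The fibre product `X ×_G X` of a point with itself is generated by two copies of the kernel and
by the diagonal section. -/
theorem isIso_of_mono_pullback_self {A X G M : C} {k : A ⟶ X} {p : X ⟶ G} {s : G ⟶ X}
    {w : k ≫ p = 0} (hk : IsLimit (KernelFork.ofι k w)) (hs : s ≫ p = 𝟙 G)
    (m : M ⟶ pullback p p) [Mono m] (a b : A ⟶ M) (c : G ⟶ M)
    (ha₁ : a ≫ m ≫ pullback.fst p p = k) (ha₂ : a ≫ m ≫ pullback.snd p p = 0)
    (hb₁ : b ≫ m ≫ pullback.fst p p = 0) (hb₂ : b ≫ m ≫ pullback.snd p p = k)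
    (hc₁ : c ≫ m ≫ pullback.fst p p = s) (hc₂ : c ≫ m ≫ pullback.snd p p = s) : IsIso m := by
  let u : X ⟶ pullback p p := pullback.lift (𝟙 X) (p ≫ s) (by simp [hs])
  -- The inverse image of `M` along x ↦ (x, s p x) contains `k` and `s`, hence is all of `X`. So `M`
  -- contains this section of the first projection, and `b` supplies its kernel.
  have hu : IsIso (pullback.snd m u) :=
    isIso_of_mono_of_factors hk hs (pullback.snd m u)
      (pullback.lift a k (by ext <;> simp [u, ha₁, ha₂, reassoc_of% w])) (by simp)
      (pullback.lift c s (by ext <;> simp [u, hc₁, hc₂, reassoc_of% hs])) (by simp)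
  obtain ⟨hl⟩ := nonempty_isLimit_kernel_pullback_fst hk p (by simp)
  refine isIso_of_mono_of_factors hl (s := u) (by simp [u]) m b ?_
    (inv (pullback.snd m u) ≫ pullback.fst m u) ?_
  · ext <;> simp [hb₁, hb₂]
  · rw [Category.assoc, pullback.condition, IsIso.inv_hom_id_assoc]

end Protomodular

/-! ### Co-smash products and the kernel of X + Y + Z → Z -/

section Kernel

variable {C : Type u} [Category.{v} C] [HasZeroMorphisms C] [HasFiniteLimits C]
  [HasFiniteColimits C]

theorem exists_coSmash_lift {T X Y : C} (t : T ⟶ X ⨿ Y) (h₁ : t ≫ coprod.desc (𝟙 X) 0 = 0)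
    (h₂ : t ≫ coprod.desc 0 (𝟙 Y) = 0) : ∃ x : T ⟶ coSmash X Y, x ≫ coSmashι X Y = t :=
  ⟨kernel.lift _ t (by ext <;> simp [comparison₂, h₁, h₂]), kernel.lift_ι _ _ _⟩

theorem exists_coSmash₃_lift {T X Y Z : C} (t : T ⟶ X ⨿ (Y ⨿ Z))
    (h₁ : t ≫ coprod.desc coprod.inl (coprod.desc coprod.inr 0) = 0)
    (h₂ : t ≫ coprod.desc coprod.inl (coprod.desc 0 coprod.inr) = 0)
    (h₃ : t ≫ coprod.desc 0 (𝟙 (Y ⨿ Z)) = 0) :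
    ∃ x : T ⟶ coSmash₃ X Y Z, x ≫ coSmash₃ι X Y Z = t := by
  have h : t ≫ comparison₃ X Y Z = 0 := by
    apply Limits.prod.hom_ext
    · simp [comparison₃, h₁]
    · apply Limits.prod.hom_ext <;> simp [comparison₃, h₂, h₃]
  exact ⟨kernel.lift _ t h, kernel.lift_ι _ _ _⟩

theorem coSmash₃ι_drop_second (X Y Z : C) :
    coSmash₃ι X Y Z ≫ coprod.desc coprod.inl (coprod.desc 0 coprod.inr) = 0 := by
  simpa [comparison₃] using congrArg (· ≫ prod.snd ≫ prod.fst) (coSmash₃ι_comparison₃ X Y Z)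

theorem coSmash₃ι_drop_first (X Y Z : C) :
    coSmash₃ι X Y Z ≫ coprod.desc 0 (𝟙 (Y ⨿ Z)) = 0 := by
  simpa [comparison₃] using congrArg (· ≫ prod.snd ≫ prod.snd) (coSmash₃ι_comparison₃ X Y Z)

theorem coSmash₃ι_desc_zero_second {X Y Z V : C} (f : X ⟶ V) (h : Z ⟶ V) :
    coSmash₃ι X Y Z ≫ coprod.desc f (coprod.desc 0 h) = 0 := by
  have e : coprod.desc f (coprod.desc (0 : Y ⟶ V) h) =
      coprod.desc coprod.inl (coprod.desc 0 coprod.inr) ≫ coprod.desc f h := by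
    ext <;> simp
  rw [e, ← Category.assoc, coSmash₃ι_drop_second, zero_comp]

theorem coSmash₃ι_desc_zero_first {X Y Z V : C} (f : Y ⨿ Z ⟶ V) :
    coSmash₃ι X Y Z ≫ coprod.desc 0 f = 0 := by
  have e : coprod.desc (0 : X ⟶ V) f = coprod.desc 0 (𝟙 (Y ⨿ Z)) ≫ f := by
    ext <;> simp
  rw [e, ← Category.assoc, coSmash₃ι_drop_first, zero_comp]

theorem coSmashι_desc_zero_right {X Y V : C} (f : X ⟶ V) :
    coSmashι X Y ≫ coprod.desc f 0 = 0 := by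
  have e : coprod.desc f (0 : Y ⟶ V) = coprod.desc (𝟙 X) 0 ≫ f := by ext <;> simp
  rw [e, ← Category.assoc, coSmashι_fst, zero_comp]

theorem coSmashι_desc_zero_left {X Y V : C} (f : Y ⟶ V) :
    coSmashι X Y ≫ coprod.desc 0 f = 0 := by
  have e : coprod.desc (0 : X ⟶ V) f = coprod.desc 0 (𝟙 Y) ≫ f := by ext <;> simp
  rw [e, ← Category.assoc, coSmashι_snd, zero_comp]

/-- The conjugation action of an abelian object on itself is trivial. -/
theorem IsAbelianObject.conj_eq_zero {X : C} (hX : IsAbelianObject X) : conj X = 0 := by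
  obtain ⟨μ, hμ₁, hμ₂⟩ := hX
  -- The codiagonal is (x, y) ↦ μ(x, 0, y) after the comparison X + X → X × X, whose kernel is the
  -- co-smash product.
  have h : (coprod.desc (𝟙 X) (𝟙 X) : X ⨿ X ⟶ X) =
      prod.lift (coprod.desc (𝟙 X) 0) (prod.lift 0 (coprod.desc 0 (𝟙 X))) ≫ μ := by
    apply coprod.hom_ext
    · simp only [← Category.assoc, prod.comp_lift, coprod.inl_desc, comp_zero, hμ₂]
    · simp only [← Category.assoc, prod.comp_lift, coprod.inr_desc, comp_zero, hμ₁]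
  rw [conj, h]
  simp only [← Category.assoc, prod.comp_lift, comp_zero, coSmashι_fst, coSmashι_snd, hμ₁]

theorem fold₂₁_ι (X Y : C) :
    fold₂₁ X Y ≫ coSmashι X Y = coSmash₃ι X X Y ≫ coprod.desc coprod.inl (𝟙 (X ⨿ Y)) :=
  kernel.lift_ι _ _ _

/-- The retraction `X + Y + Z ⟶ Z`. -/
noncomputable def retractionThird (X Y Z : C) : X ⨿ (Y ⨿ Z) ⟶ Z :=
  coprod.desc 0 (coprod.desc 0 (𝟙 Z))

/-- The kernel of `X + Y + Z ⟶ Z` is generated by its intersections with `X + Z` and `Y + Z`, the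
co-smash product `X ⊗ Y` and the co-smash product `X ⊗ Y ⊗ Z`. -/
theorem kernel_retractionThird_hom_ext [IsProtomodular C] {X Y Z V : C}
    {f g : kernel (retractionThird X Y Z) ⟶ V}
    (h₁ : ∀ {T : C} (t : T ⟶ kernel (retractionThird X Y Z)) (x : T ⟶ X ⨿ Z),
      t ≫ kernel.ι _ = x ≫ coprod.desc coprod.inl (coprod.inr ≫ coprod.inr) → t ≫ f = t ≫ g)
    (h₂ : ∀ {T : C} (t : T ⟶ kernel (retractionThird X Y Z)) (x : T ⟶ Y ⨿ Z),
      t ≫ kernel.ι _ = x ≫ coprod.inr → t ≫ f = t ≫ g)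
    (h₃ : ∀ {T : C} (t : T ⟶ kernel (retractionThird X Y Z)) (x : T ⟶ coSmash X Y),
      t ≫ kernel.ι _ = x ≫ coSmashι X Y ≫ coprod.desc coprod.inl (coprod.inl ≫ coprod.inr) →
        t ≫ f = t ≫ g)
    (h₄ : ∀ {T : C} (t : T ⟶ kernel (retractionThird X Y Z)) (x : T ⟶ coSmash₃ X Y Z),
      t ≫ kernel.ι _ = x ≫ coSmash₃ι X Y Z → t ≫ f = t ≫ g) : f = g := by
  let κ := kernel.ι (retractionThird X Y Z)
  let d₁ : X ⨿ (Y ⨿ Z) ⟶ Y ⨿ Z := coprod.desc 0 (𝟙 _)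
  let d₂ : X ⨿ (Y ⨿ Z) ⟶ X ⨿ Z := coprod.desc coprod.inl (coprod.desc 0 coprod.inr)
  let d₃ : X ⨿ (Y ⨿ Z) ⟶ X ⨿ Y := coprod.desc coprod.inl (coprod.desc coprod.inr 0)
  let i₁ : Y ⨿ Z ⟶ X ⨿ (Y ⨿ Z) := coprod.inr
  let i₂ : X ⨿ Z ⟶ X ⨿ (Y ⨿ Z) := coprod.desc coprod.inl (coprod.inr ≫ coprod.inr)
  let i₃ : X ⨿ Y ⟶ X ⨿ (Y ⨿ Z) := coprod.desc coprod.inl (coprod.inl ≫ coprod.inr)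
  have hd₁ : i₁ ≫ d₁ = 𝟙 _ := by simp [i₁, d₁]
  have hd₂ : i₂ ≫ d₂ = 𝟙 _ := by ext <;> simp [i₂, d₂]
  have hd₃ : i₃ ≫ d₃ = 𝟙 _ := by ext <;> simp [i₃, d₃]
  have hr₁ : d₁ ≫ i₁ ≫ retractionThird X Y Z = retractionThird X Y Z := by
    ext <;> simp [d₁, i₁, retractionThird]
  have hr₂ : d₂ ≫ i₂ ≫ retractionThird X Y Z = retractionThird X Y Z := by
    ext <;> simp [d₂, i₂, retractionThird]
  have hr₃ : d₃ ≫ i₃ ≫ retractionThird X Y Z = 0 := by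
    ext <;> simp [d₃, i₃, retractionThird]
  -- The idempotents `e₁`, `e₂`, `e₃` delete X, Y and Z respectively; they commute.
  let e₁ : kernel (retractionThird X Y Z) ⟶ kernel (retractionThird X Y Z) :=
    kernel.lift _ (κ ≫ d₁ ≫ i₁) (by simp [hr₁, κ])
  let e₂ : kernel (retractionThird X Y Z) ⟶ kernel (retractionThird X Y Z) :=
    kernel.lift _ (κ ≫ d₂ ≫ i₂) (by simp [hr₂, κ])
  let e₃ : kernel (retractionThird X Y Z) ⟶ kernel (retractionThird X Y Z) :=
    kernel.lift _ (κ ≫ d₃ ≫ i₃) (by simp [hr₃])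
  have he₁ : e₁ ≫ κ = κ ≫ d₁ ≫ i₁ := kernel.lift_ι _ _ _
  have he₂ : e₂ ≫ κ = κ ≫ d₂ ≫ i₂ := kernel.lift_ι _ _ _
  have he₃ : e₃ ≫ κ = κ ≫ d₃ ≫ i₃ := kernel.lift_ι _ _ _
  have idem₁ : e₁ ≫ e₁ = e₁ := by
    rw [← cancel_mono κ, Category.assoc, he₁, reassoc_of% he₁, reassoc_of% hd₁]
  have idem₂ : e₂ ≫ e₂ = e₂ := by
    rw [← cancel_mono κ, Category.assoc, he₂, reassoc_of% he₂, reassoc_of% hd₂]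
  have idem₃ : e₃ ≫ e₃ = e₃ := by
    rw [← cancel_mono κ, Category.assoc, he₃, reassoc_of% he₃, reassoc_of% hd₃]
  have c₁₂ : e₁ ≫ e₂ = e₂ ≫ e₁ := by
    rw [← cancel_mono κ, Category.assoc, Category.assoc, he₁, he₂, reassoc_of% he₁,
      reassoc_of% he₂]
    congr 1
    ext <;> simp [d₁, d₂, i₁, i₂]
  have c₁₃ : e₁ ≫ e₃ = e₃ ≫ e₁ := by
    rw [← cancel_mono κ, Category.assoc, Category.assoc, he₁, he₃, reassoc_of% he₁,
      reassoc_of% he₃]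
    congr 1
    ext <;> simp [d₁, d₃, i₁, i₃]
  have c₂₃ : e₂ ≫ e₃ = e₃ ≫ e₂ := by
    rw [← cancel_mono κ, Category.assoc, Category.assoc, he₂, he₃, reassoc_of% he₂,
      reassoc_of% he₃]
    congr 1
    ext <;> simp [d₂, d₃, i₂, i₃]
  have z₁ : ∀ {T : C} (t : T ⟶ kernel (retractionThird X Y Z)), t ≫ e₁ = 0 → t ≫ κ ≫ d₁ = 0 := by
    intro T t ht
    have := congrArg (· ≫ κ ≫ d₁) ht
    simpa only [Category.assoc, reassoc_of% he₁, hd₁, zero_comp, Category.comp_id] using this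
  have z₂ : ∀ {T : C} (t : T ⟶ kernel (retractionThird X Y Z)), t ≫ e₂ = 0 → t ≫ κ ≫ d₂ = 0 := by
    intro T t ht
    have := congrArg (· ≫ κ ≫ d₂) ht
    simpa only [Category.assoc, reassoc_of% he₂, hd₂, zero_comp, Category.comp_id] using this
  have z₃ : ∀ {T : C} (t : T ⟶ kernel (retractionThird X Y Z)), t ≫ e₃ = 0 → t ≫ κ ≫ d₃ = 0 := by
    intro T t ht
    have := congrArg (· ≫ κ ≫ d₃) ht
    simpa only [Category.assoc, reassoc_of% he₃, hd₃, zero_comp, Category.comp_id] using this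
  -- Each idempotent separates what it fixes from what it kills: fixed by `e₂` gives X + Z; killed
  -- by `e₂` and fixed by `e₁` gives Y + Z; killed by both and fixed by `e₃` gives X ⊗ Y; killed by
  -- all three gives X ⊗ Y ⊗ Z.
  refine hom_ext_of_idempotent idem₂ (h₁ e₂ (κ ≫ d₂) (by simpa using he₂)) fun t ht₂ => ?_
  refine comp_eq_comp_of_idempotent idem₁ e₂ e₁ c₁₂ ?_ ?_ t ht₂
  · intro T t _ ht₁
    refine h₂ t (t ≫ κ ≫ d₁) ?_
    conv_lhs => rw [← ht₁]
    simpa using congrArg (t ≫ ·) he₁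
  intro T t ht₂ ht₁
  refine comp_eq_comp_of_idempotent idem₃ (prod.lift e₁ e₂) (prod.map e₃ e₃)
    (by ext <;> simp [c₁₃, c₂₃]) ?_ ?_ t (by ext <;> simp [ht₁, ht₂])
  · intro T t ht ht₃
    have ht₁ : t ≫ e₁ = 0 := by simpa using congrArg (· ≫ prod.fst) ht
    have ht₂ : t ≫ e₂ = 0 := by simpa using congrArg (· ≫ prod.snd) ht
    obtain ⟨x, hx⟩ := exists_coSmash_lift (t ≫ κ ≫ d₃) (by
      have := congrArg (· ≫ coprod.desc (𝟙 X) 0) (z₂ t ht₂)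
      have h : d₃ ≫ coprod.desc (𝟙 X) 0 = d₂ ≫ coprod.desc (𝟙 X) 0 := by
        ext <;> simp [d₂, d₃]
      simpa [h] using this) (by
      have := congrArg (· ≫ coprod.desc (𝟙 Y) 0) (z₁ t ht₁)
      have h : d₃ ≫ coprod.desc 0 (𝟙 Y) = d₁ ≫ coprod.desc (𝟙 Y) 0 := by
        ext <;> simp [d₁, d₃]
      simpa [h] using this)
    refine h₃ t x ?_
    rw [reassoc_of% hx]
    conv_lhs => rw [← ht₃]
    simpa using congrArg (t ≫ ·) he₃
  · intro T t ht ht₃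
    have ht₁ : t ≫ e₁ = 0 := by simpa using congrArg (· ≫ prod.fst) ht
    have ht₂ : t ≫ e₂ = 0 := by simpa using congrArg (· ≫ prod.snd) ht
    obtain ⟨x, hx⟩ := exists_coSmash₃_lift (t ≫ κ) ((Category.assoc _ _ _).trans (z₃ t ht₃))
      ((Category.assoc _ _ _).trans (z₂ t ht₂)) ((Category.assoc _ _ _).trans (z₁ t ht₁))
    exact h₄ t x hx.symm

end Kernel

/-! ### Actions, the ternary operation and the equivalence -/

section Actions

variable {C : Type u} [Category.{v} C] [HasZeroMorphisms C]

section

variable [HasFiniteLimits C] [HasFiniteColimits C] {A G : C} (ψ : coSmash A G ⟶ A)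

theorem semidirectK_P : semidirectK ψ ≫ semidirectP ψ = 0 := by
  rw [semidirectK, semidirectP, Category.assoc, semidirectπ_desc, coprod.inl_desc]

theorem semidirectπ_eq : semidirectπ ψ = coprod.desc (semidirectK ψ) (semidirectS ψ) := by
  ext <;> simp [semidirectK, semidirectS]

theorem coSmashι_semidirectπ : coSmashι A G ≫ semidirectπ ψ = ψ ≫ semidirectK ψ := by
  exact (coequalizer.condition (coSmashι A G) (ψ ≫ coprod.inl)).trans (Category.assoc _ _ _)

/-- The morphism `A + A + G ⟶ A ⋊ G` which folds the two copies of `A` together restricts to the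
ternary operation. -/
theorem coSmash₃ι_desc_semidirect :
    coSmash₃ι A A G ≫ coprod.desc (semidirectK ψ) (coprod.desc (semidirectK ψ) (semidirectS ψ)) =
      ternary₂₁ ψ ≫ semidirectK ψ := by
  rw [ternary₂₁, Category.assoc, ← coSmashι_semidirectπ, ← Category.assoc, fold₂₁_ι,
    Category.assoc, ← semidirectπ_eq]
  congr 1
  ext <;> simp [semidirectK]

end

section

variable [CategoryTheory.Regular C] [IsProtomodular C] [HasFiniteColimits C] {A G : C}

/-- The kernel of A + G → G is generated by A and A ⊗ G, and `q` sends both into A, the latter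
through ψ. Since `q` restricts to a regular epimorphism from this kernel onto the kernel of `p`, the
monomorphism from A to the latter is a strong epimorphism as well. -/
theorem nonempty_isLimit_of_coSmashι_comp_eq {X : C} {q : A ⨿ G ⟶ X} [IsRegularEpi q] {k : A ⟶ X}
    [Mono k] (hqk : coprod.inl ≫ q = k) {p : X ⟶ G} (hqp : q ≫ p = coprod.desc 0 (𝟙 G))
    {ψ : coSmash A G ⟶ A} (hψ : coSmashι A G ≫ q = ψ ≫ k) (w : k ≫ p = 0) :
    Nonempty (IsLimit (KernelFork.ofι k w)) := by
  let j : A ⟶ kernel p := kernel.lift _ k w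
  have hj : j ≫ kernel.ι p = k := kernel.lift_ι _ _ _
  have hjmono : Mono j := mono_of_mono_fac hj
  let a : A ⟶ pullback (kernel.ι p) q := pullback.lift j coprod.inl (hj.trans hqk.symm)
  let b : coSmash A G ⟶ pullback (kernel.ι p) q :=
    pullback.lift (ψ ≫ j) (coSmashι A G) (by rw [Category.assoc, hj, hψ])
  let d : pullback (kernel.ι p) q ⟶ A := pullback.snd _ q ≫ coprod.desc (𝟙 A) 0
  have hb : b ≫ d = 0 := by simp [b, d, coSmashι_fst]
  have hafst : a ≫ pullback.fst _ q = j := pullback.lift_fst _ _ _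
  have hasnd : a ≫ pullback.snd _ q = coprod.inl := pullback.lift_snd _ _ _
  have ha : a ≫ d = 𝟙 A := by rw [← Category.assoc, hasnd, coprod.inl_desc]
  have hbsnd : b ≫ pullback.snd _ q = coSmashι A G := pullback.lift_snd _ _ _
  have : Mono (coSmashι A G) := inferInstanceAs (Mono (kernel.ι _))
  have : Mono b := mono_of_mono_fac hbsnd
  have hlim : IsLimit (KernelFork.ofι b hb) := KernelFork.IsLimit.ofι' _ _ fun {T} t ht => by
    have hx := exists_coSmash_lift (t ≫ pullback.snd (kernel.ι p) q) (by simpa [d] using ht) (by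
      rw [← hqp, Category.assoc, ← pullback.condition_assoc, kernel.condition, comp_zero,
        comp_zero])
    refine ⟨hx.choose, ?_⟩
    rw [← cancel_mono (pullback.snd (kernel.ι p) q), Category.assoc, hbsnd, hx.choose_spec]
  -- The inverse image of A in the pullback contains both generators, so it is everything.
  have : IsIso (pullback.snd j (pullback.fst (kernel.ι p) q)) :=
    isIso_of_mono_of_factors hlim ha _
      (pullback.lift ψ b (by simp [b])) (by simp)
      (pullback.lift (𝟙 A) a (by rw [Category.id_comp, hafst])) (by simp)
  have hfac : (inv (pullback.snd j (pullback.fst (kernel.ι p) q)) ≫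
      pullback.fst j (pullback.fst (kernel.ι p) q)) ≫ j = pullback.fst (kernel.ι p) q := by
    rw [Category.assoc, pullback.condition, IsIso.inv_hom_id_assoc]
  have : StrongEpi (pullback.fst (kernel.ι p) q) := inferInstance
  have : StrongEpi j := by
    rw [← hfac] at this
    exact strongEpi_of_strongEpi
      (inv (pullback.snd j (pullback.fst (kernel.ι p) q)) ≫ pullback.fst j _) j
  have : IsIso j := isIso_of_mono_of_strongEpi j
  refine ⟨KernelFork.IsLimit.ofι' _ _ fun {T} t ht => ⟨kernel.lift _ t ht ≫ inv j, ?_⟩⟩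
  rw [Category.assoc, ← hj, IsIso.inv_hom_id_assoc, kernel.lift_ι]

/-- If `ψ` determines an action, then `k_ψ` is the kernel of `p_ψ`. -/
theorem DeterminesAction.nonempty_isLimit {ψ : coSmash A G ⟶ A} (hψ : DeterminesAction ψ) :
    Nonempty (IsLimit (KernelFork.ofι (semidirectK ψ) (semidirectK_P ψ))) := by
  have : Mono (semidirectK ψ) := hψ
  have : IsRegularEpi (semidirectπ ψ) := inferInstanceAs (IsRegularEpi (coequalizer.π _ _))
  exact nonempty_isLimit_of_coSmashι_comp_eq (k := semidirectK ψ) rfl (semidirectπ_desc _ _ _ _)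
    (coSmashι_semidirectπ ψ) _

end

/-- If the point of an action carries a unital multiplication, then the ternary operation is
trivial. -/
theorem UnitalMultiplication.ternary₂₁_eq_zero [HasFiniteLimits C] [HasFiniteColimits C] {A G : C}
    {ψ : coSmash A G ⟶ A} (hψ : DeterminesAction ψ)
    (m : UnitalMultiplication (semidirectP ψ) (semidirectS ψ) (semidirectS_P ψ)) :
    ternary₂₁ ψ = 0 := by
  have hmono : Mono (semidirectK ψ) := hψ
  let a : A ⨿ (A ⨿ G) ⟶ semidirect ψ :=
    coprod.desc (semidirectK ψ) (coprod.desc 0 (semidirectS ψ))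
  let b : A ⨿ (A ⨿ G) ⟶ semidirect ψ :=
    coprod.desc 0 (coprod.desc (semidirectK ψ) (semidirectS ψ))
  have hab : a ≫ semidirectP ψ = b ≫ semidirectP ψ := by
    ext <;> simp [a, b, semidirectK_P]
  have h : m.op a b hab =
      coprod.desc (semidirectK ψ) (coprod.desc (semidirectK ψ) (semidirectS ψ)) := by
    have hK := semidirectK_P ψ
    have hS := semidirectS_P ψ
    apply coprod.hom_ext
    · rw [m.comp_op_one] <;> simp [a, b, reassoc_of% hK]
    · apply coprod.hom_ext
      · rw [← Category.assoc, m.comp_one_op] <;> simp [a, b, reassoc_of% hK]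
      · rw [← Category.assoc, m.comp_one_op] <;> simp [a, b, reassoc_of% hS]
  have ha : coSmash₃ι A A G ≫ a = 0 := coSmash₃ι_desc_zero_second _ _
  have hb : coSmash₃ι A A G ≫ b = 0 := coSmash₃ι_desc_zero_first _
  rw [← cancel_mono (semidirectK ψ), ← coSmash₃ι_desc_semidirect, ← h,
    m.comp_op_one _ _ _ _ (by rw [hb, reassoc_of% ha, zero_comp]), ha, zero_comp]

/-- A point with abelian kernel `A` carries a unital multiplication as soon as the folding morphism
`A + A + G ⟶ X` vanishes on `A ⊗ A ⊗ G`. -/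
theorem nonempty_unitalMultiplication_of_coSmash₃ι_comp_eq_zero [CategoryTheory.Regular C]
    [IsProtomodular C] [HasFiniteColimits C] {A G X : C} (hA : IsAbelianObject A)
    {k : A ⟶ X} {p : X ⟶ G} {s : G ⟶ X} {hkp : k ≫ p = 0} (hk : IsLimit (KernelFork.ofι k hkp))
    (hsp : s ≫ p = 𝟙 G)
    (h : coSmash₃ι A A G ≫ coprod.desc k (coprod.desc k s) = 0) :
    Nonempty (UnitalMultiplication p s hsp) := by
  have hmono : Mono k := mono_of_isLimit_fork hk
  have hconj := hA.conj_eq_zero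
  obtain ⟨μ, hμ₁, hμ₂⟩ := hA
  let a : A ⨿ (A ⨿ G) ⟶ X := coprod.desc k (coprod.desc 0 s)
  let b : A ⨿ (A ⨿ G) ⟶ X := coprod.desc 0 (coprod.desc k s)
  let c : A ⨿ (A ⨿ G) ⟶ X := coprod.desc k (coprod.desc k s)
  have hap : a ≫ p = retractionThird A A G := by ext <;> simp [a, hkp, hsp, retractionThird]
  have hbp : b ≫ p = retractionThird A A G := by ext <;> simp [b, hkp, hsp, retractionThird]
  have hcp : c ≫ p = retractionThird A A G := by ext <;> simp [c, hkp, hsp, retractionThird]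
  let r : A ⨿ (A ⨿ G) ⟶ pullback p p := pullback.lift a b (hap.trans hbp.symm)
  have hr₁ : r ≫ pullback.fst p p = a := pullback.lift_fst _ _ _
  have hr₂ : r ≫ pullback.snd p p = b := pullback.lift_snd _ _ _
  -- The three summands give the two copies of the kernel and the diagonal section, which generate
  -- the fibre product. Thus `r` is extremal, hence regular in a regular category.
  have hr : ∀ {M : C} (e : A ⨿ (A ⨿ G) ⟶ M) (m : M ⟶ pullback p p), e ≫ m = r → Mono m →
      IsIso m := by
    intro M e m hem _
    have h₁ : e ≫ m ≫ pullback.fst p p = a := by rw [reassoc_of% hem, hr₁]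
    have h₂ : e ≫ m ≫ pullback.snd p p = b := by rw [reassoc_of% hem, hr₂]
    exact isIso_of_mono_pullback_self hk hsp m (coprod.inl ≫ e) (coprod.inl ≫ coprod.inr ≫ e)
      (coprod.inr ≫ coprod.inr ≫ e) (by simp [h₁, a]) (by simp [h₂, b]) (by simp [h₁, a])
      (by simp [h₂, b]) (by simp [h₁, a]) (by simp [h₂, b])
  have hrepi : Epi r := ⟨fun f g hfg => by
    have := hr (equalizer.lift r hfg) (equalizer.ι f g) (equalizer.lift_ι _ _) inferInstance
    rw [← cancel_epi (equalizer.ι f g), equalizer.condition]⟩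
  have hrext : ExtremalEpi r := { isIso := fun e m hem _ => hr e m hem inferInstance }
  have hrreg : IsRegularEpi r := inferInstance
  have lift : ∀ x : A ⨿ (A ⨿ G) ⟶ X, x ≫ p = retractionThird A A G →
      ∃ y : kernel (retractionThird A A G) ⟶ A, y ≫ k = kernel.ι _ ≫ x := fun x hx =>
    ⟨_, (KernelFork.IsLimit.lift' hk (kernel.ι _ ≫ x)
      ((Category.assoc _ _ _).trans (by rw [hx, kernel.condition]))).2⟩
  obtain ⟨a', ha'⟩ := lift a hap
  obtain ⟨b', hb'⟩ := lift b hbp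
  obtain ⟨c', hc'⟩ := lift c hcp
  -- This is the identity c' = a' + b', the sum being μ(x, 0, y).
  have key : c' = prod.lift a' (prod.lift 0 b') ≫ μ := by
    have hsum : ∀ {T : C} (t : T ⟶ kernel (retractionThird A A G)),
        t ≫ prod.lift a' (prod.lift 0 b') ≫ μ =
          prod.lift (t ≫ a') (prod.lift 0 (t ≫ b')) ≫ μ := by
      intro T t
      rw [← Category.assoc, prod.comp_lift, prod.comp_lift, comp_zero]
    have hlift : ∀ {T : C} (t : T ⟶ kernel (retractionThird A A G)) (y : _ ⟶ A)
        (x : A ⨿ (A ⨿ G) ⟶ X), y ≫ k = kernel.ι _ ≫ x →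
        (t ≫ kernel.ι (retractionThird A A G)) ≫ x = 0 → t ≫ y = 0 := by
      intro T t y x h₁ h₂
      rw [← cancel_mono k, Category.assoc, h₁, ← Category.assoc, h₂, zero_comp]
    have hs : ∀ {T : C} (x : T ⟶ A ⨿ G), x ≫ coprod.desc 0 (𝟙 G) = 0 →
        x ≫ coprod.desc 0 s = 0 := by
      intro T x hx
      have e : coprod.desc (0 : A ⟶ X) s = coprod.desc 0 (𝟙 G) ≫ s := by ext <;> simp
      rw [e, ← Category.assoc, hx, zero_comp]
    apply kernel_retractionThird_hom_ext
    · intro T t x hx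
      have hx₀ : x ≫ coprod.desc 0 (𝟙 G) = 0 := by
        have e : coprod.desc coprod.inl (coprod.inr ≫ coprod.inr) ≫ retractionThird A A G =
            coprod.desc 0 (𝟙 G) := by ext <;> simp [retractionThird]
        rw [← e, ← Category.assoc, ← hx, Category.assoc, kernel.condition, comp_zero]
      have hb₀ : t ≫ b' = 0 := by
        refine hlift t b' b hb' ?_
        have e : coprod.desc coprod.inl (coprod.inr ≫ coprod.inr) ≫ b = coprod.desc 0 s := by
          ext <;> simp [b]
        rw [hx, Category.assoc, e, hs x hx₀]
      have hca : t ≫ c' = t ≫ a' := by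
        have e : coprod.desc coprod.inl (coprod.inr ≫ coprod.inr) ≫ c =
            coprod.desc coprod.inl (coprod.inr ≫ coprod.inr) ≫ a := by
          ext <;> simp [a, c]
        rw [← cancel_mono k, Category.assoc, Category.assoc, hc', ha', ← Category.assoc, hx,
          Category.assoc, e, ← Category.assoc, ← hx, Category.assoc]
      rw [hsum, hb₀, hμ₂, hca]
    · intro T t x hx
      have hx₀ : x ≫ coprod.desc 0 (𝟙 G) = 0 := by
        have e : coprod.inr ≫ retractionThird A A G = coprod.desc 0 (𝟙 G) := by
          simp [retractionThird]
        rw [← e, ← Category.assoc, ← hx, Category.assoc, kernel.condition, comp_zero]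
      have ha₀ : t ≫ a' = 0 := by
        refine hlift t a' a ha' ?_
        have e : coprod.inr ≫ a = coprod.desc 0 s := by simp [a]
        rw [hx, Category.assoc, e, hs x hx₀]
      have hcb : t ≫ c' = t ≫ b' := by
        have e : coprod.inr ≫ c = coprod.inr ≫ b := by simp [b, c]
        rw [← cancel_mono k, Category.assoc, Category.assoc, hc', hb', ← Category.assoc, hx,
          Category.assoc, e, ← Category.assoc, ← hx, Category.assoc]
      rw [hsum, ha₀, hμ₁, hcb]
    · intro T t x hx
      have ha₀ : t ≫ a' = 0 := by
        refine hlift t a' a ha' ?_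
        have e : coprod.desc coprod.inl (coprod.inl ≫ coprod.inr) ≫ a = coprod.desc k 0 := by
          ext <;> simp [a]
        rw [hx, Category.assoc, Category.assoc, e, coSmashι_desc_zero_right, comp_zero]
      have hb₀ : t ≫ b' = 0 := by
        refine hlift t b' b hb' ?_
        have e : coprod.desc coprod.inl (coprod.inl ≫ coprod.inr) ≫ b = coprod.desc 0 k := by
          ext <;> simp [b]
        rw [hx, Category.assoc, Category.assoc, e, coSmashι_desc_zero_left, comp_zero]
      have hc₀ : t ≫ c' = 0 := by
        refine hlift t c' c hc' ?_
        have e : coprod.desc coprod.inl (coprod.inl ≫ coprod.inr) ≫ c =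
            coprod.desc (𝟙 A) (𝟙 A) ≫ k := by
          ext <;> simp [c]
        rw [hx, Category.assoc, Category.assoc, e, ← Category.assoc (coSmashι A A), ← conj, hconj,
          zero_comp, comp_zero]
      rw [hsum, ha₀, hb₀, hμ₁, hc₀]
    · intro T t x hx
      have ha₀ : t ≫ a' = 0 := by
        refine hlift t a' a ha' ?_
        rw [hx, Category.assoc, coSmash₃ι_desc_zero_second, comp_zero]
      have hb₀ : t ≫ b' = 0 := by
        refine hlift t b' b hb' ?_
        rw [hx, Category.assoc, coSmash₃ι_desc_zero_first, comp_zero]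
      have hc₀ : t ≫ c' = 0 := by
        refine hlift t c' c hc' ?_
        rw [hx, Category.assoc, h, comp_zero]
      rw [hsum, ha₀, hb₀, hμ₁, hc₀]
  -- Both components of `r` vanish on its kernel, hence so do a', b' and their sum.
  have hker : kernel.ι r ≫ c = 0 := by
    have hρ : kernel.ι r ≫ retractionThird A A G = 0 := by
      rw [← hap, ← hr₁, Category.assoc, kernel.condition_assoc, zero_comp]
    have hρι := kernel.lift_ι _ _ hρ
    have ha₀ : kernel.lift _ _ hρ ≫ a' = 0 := by
      rw [← cancel_mono k, Category.assoc, ha', reassoc_of% hρι, ← hr₁, kernel.condition_assoc,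
        zero_comp, zero_comp]
    have hb₀ : kernel.lift _ _ hρ ≫ b' = 0 := by
      rw [← cancel_mono k, Category.assoc, hb', reassoc_of% hρι, ← hr₂, kernel.condition_assoc,
        zero_comp, zero_comp]
    have hc₀ : kernel.lift _ _ hρ ≫ c' = 0 := by
      rw [key, ← Category.assoc, prod.comp_lift, prod.comp_lift, ha₀, hb₀, comp_zero, hμ₁]
    rw [← hρι, Category.assoc, ← hc', ← Category.assoc, hc₀, zero_comp]
  obtain ⟨m, hm⟩ := exists_desc_of_kernel_comp_eq_zero r c hker
  have hπ : ∀ {Z : C} {f g : X ⟶ Z}, k ≫ f = k ≫ g → s ≫ f = s ≫ g → f = g :=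
    fun h₁ h₂ => hom_ext_of_split hk hsp h₁ h₂
  -- The unit laws are tested on `k` and `s`, where the pairs (x, 1) and (1, x) come from coproduct
  -- summands through `r`.
  refine ⟨⟨m, hπ ?_ ?_, hπ ?_ ?_⟩⟩
  · have : k ≫ pullback.lift (𝟙 _) (p ≫ s) (by simp [hsp]) = coprod.inl ≫ r := by
      ext <;> simp [r, a, b, reassoc_of% hkp]
    rw [← Category.assoc, this, Category.assoc, hm]
    simp [c]
  · have : s ≫ pullback.lift (𝟙 _) (p ≫ s) (by simp [hsp]) = coprod.inr ≫ coprod.inr ≫ r := by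
      ext <;> simp [r, a, b, reassoc_of% hsp]
    rw [← Category.assoc, this, Category.assoc, Category.assoc, hm]
    simp [c]
  · have : k ≫ pullback.lift (p ≫ s) (𝟙 _) (by simp [hsp]) = coprod.inl ≫ coprod.inr ≫ r := by
      ext <;> simp [r, a, b, reassoc_of% hkp]
    rw [← Category.assoc, this, Category.assoc, Category.assoc, hm]
    simp [c]
  · have : s ≫ pullback.lift (p ≫ s) (𝟙 _) (by simp [hsp]) = coprod.inr ≫ coprod.inr ≫ r := by
      ext <;> simp [r, a, b, reassoc_of% hsp]
    rw [← Category.assoc, this, Category.assoc, Category.assoc, hm]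
    simp [c]

/-- If the ternary operation of an action on an abelian object is trivial, then the point of the
action carries a unital multiplication. -/
theorem nonempty_unitalMultiplication_of_ternary₂₁_eq_zero [CategoryTheory.Regular C]
    [IsProtomodular C] [HasFiniteColimits C] {A G : C} (hA : IsAbelianObject A)
    {ψ : coSmash A G ⟶ A} (hψ : DeterminesAction ψ) (h : ternary₂₁ ψ = 0) :
    Nonempty (UnitalMultiplication (semidirectP ψ) (semidirectS ψ) (semidirectS_P ψ)) := by
  obtain ⟨hk⟩ := hψ.nonempty_isLimit
  exact nonempty_unitalMultiplication_of_coSmash₃ι_comp_eq_zero hA hk (semidirectS_P ψ)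
    (by rw [coSmash₃ι_desc_semidirect, h, zero_comp])

theorem isPrecrossedModule_zero [HasFiniteLimits C] [HasFiniteColimits C] {A G : C}
    {ψ : coSmash A G ⟶ A} (hψ : DeterminesAction ψ) : IsPrecrossedModule G A ψ 0 where
  action := hψ
  equivariant := by
    have h : coprod.map (0 : A ⟶ G) (𝟙 G) ≫ coprod.desc (𝟙 G) (𝟙 G) = coprod.desc 0 (𝟙 G) := by
      ext <;> simp
    rw [conj, ← Category.assoc, coSmashMap_ι, Category.assoc, h, coSmashι_snd, comp_zero]

theorem isCrossedModule_zero_iff [HasFiniteLimits C] [HasFiniteColimits C] [IsProtomodular C]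
    {A G : C} {ψ : coSmash A G ⟶ A} (hψ : DeterminesAction ψ) : IsCrossedModule G A ψ 0 ↔
      Nonempty (UnitalMultiplication (semidirectP ψ) (semidirectS ψ) (semidirectS_P ψ)) :=
  -- For ∂ = 0 the codomain is `semidirectP ψ` by definition, so composable pairs are exactly pairs
  -- in one fibre.
  ⟨fun ⟨_, ⟨m⟩⟩ => ⟨⟨m.comp, m.comp_id, m.id_comp⟩⟩,
    fun ⟨m⟩ => ⟨isPrecrossedModule_zero hψ, ⟨m.internalCategoryStructure⟩⟩⟩

end Actions

end CoSmash

theorem theorem6p1 {C : Type*} [Category C] [HasZeroObject C] [HasZeroMorphisms C]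
    [CategoryTheory.Regular C] [CoSmash.IsProtomodular C] [HasFiniteColimits C]
    {A G : C} (hA : CoSmash.IsAbelianObject A)
    (ψ : CoSmash.coSmash A G ⟶ A) (hψ : CoSmash.DeterminesAction ψ) :
    [CoSmash.IsModule ψ,
      CoSmash.IsCrossedModule G A ψ 0,
      CoSmash.ternary₂₁ ψ = 0].TFAE := by
  tfae_have 1 → 2 := fun h =>
    (CoSmash.isCrossedModule_zero_iff hψ).2 h.2.nonempty_unitalMultiplication
  tfae_have 2 → 3 := fun h => by
    obtain ⟨m⟩ := (CoSmash.isCrossedModule_zero_iff hψ).1 h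
    exact m.ternary₂₁_eq_zero hψ
  tfae_have 3 → 1 := fun h => by
    obtain ⟨m⟩ := CoSmash.nonempty_unitalMultiplication_of_ternary₂₁_eq_zero hA hψ h
    exact ⟨hψ, m.isBeckModulePoint⟩
  tfae_finish
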